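/- Let $G$ be a locally compact abelian (Hausdorff) group. A cut-and-project scheme $(G,H,\mathcal L)$ consists of a locally compact abelian group $H$ and a discrete and cocompact subgroup $\mathcal L\subseteq G\times H$ which projects injectively to $G$ and densely to $H$. For $W\subseteq H$ put $\Lambda_W=\pi^G(\mathcal L\cap(G\times W))$, where $\pi^G\colon G\times H\to G$ is the projection. Consider a set $\Gamma\subseteq G$. (1) $\Gamma$ is a regular model set if there are a cut-and-project scheme $(G,H,\mathcal L)$ and a relatively compact Borel set $W\subseteq H$ with non-empty interior $W^\circ$ and with boundary $\partial W=\overline W\setminus W^\circ$ of zero Haar measure such that $\Gamma=\Lambda_W$. (2) $\Gamma$ is an inter regular model set if there are a cut-and-project scheme $(G,H,\mathcal L)$ and $W\subseteq H$ as in (1) such that $\Lambda_{W^\circ}\subseteq\Gamma\subseteq\Lambda_{\overline W}$. (3) $\Gamma$ is an almost regular model set if there are a cut-and-project scheme $(G,H,\mathcal L)$ and sets $U\subseteq W\subseteq H$, with $U$ non-empty and open, $W$ compact and $W\setminus U$ of zero Haar measure, such that $\Lambda_U\subseteq\Gamma\subseteq\Lambda_W$. For a locally finite set $\Gamma\subseteq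 G$, the hull $\mathbb X(\Gamma)$ is the set of all locally finite $\Gamma'\subseteq G$ such that $\sum_{x\in\Gamma'}\delta_x$ lies in the closure of $\{\sum_{x\in s+\Gamma}\delta_x : s\in G\}$ in the vague topology, i.e. the topology of pointwise convergence on the continuous functions $G\to\mathbb R$ with compact support. (All sets in (1)--(3) are locally finite.) Claim: if $\Gamma$ is an almost regular model set, then there exists some $\Gamma'\in\mathbb X(\Gamma)$ which is a regular model set. In particular, if $\Gamma$ is an inter regular model set, then there exists some $\Gamma'\in\mathbb X(\Gamma)$ which is a regular model set. -/

import Mathlib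

open MeasureTheory Set

open scoped CompactlySupported

universe u

/-- A cut-and-project scheme with direct space `G` and internal space `H`: a lattice in `G × H`,
that is, a discrete and cocompact subgroup, which projects injectively to `G` and densely to `H`. -/
structure CutAndProjectScheme (G H : Type u) [AddCommGroup G] [TopologicalSpace G]
    [AddCommGroup H] [TopologicalSpace H] where
  lattice : AddSubgroup (G × H)
  discrete : DiscreteTopology lattice
  cocompact : CompactSpace ((G × H) ⧸ lattice)
  injOn_fst : InjOn Prod.fst (lattice : Set (G × H))
  dense_snd : Dense (Prod.snd '' (lattice : Set (G × H)))

/-- The projection set `Λ_W = π^G (L ∩ (G × W))`. -/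
def CutAndProjectScheme.projectionSet {G H : Type u} [AddCommGroup G] [TopologicalSpace G]
    [AddCommGroup H] [TopologicalSpace H] (S : CutAndProjectScheme G H) (W : Set H) : Set G :=
  Prod.fst '' ((S.lattice : Set (G × H)) ∩ (univ ×ˢ W))

/-- A window of a regular model set: relatively compact, Borel measurable, with non-empty interior
and with a topological boundary of zero Haar measure. -/
structure IsRegularWindow {H : Type u} [AddCommGroup H] [TopologicalSpace H]
    [IsTopologicalAddGroup H] [LocallyCompactSpace H] [MeasurableSpace H] [BorelSpace H]
    (W : Set H) : Prop where
  isCompact_closure : IsCompact (closure W)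
  measurableSet : MeasurableSet W
  interior_nonempty : (interior W).Nonempty
  haar_frontier : Measure.addHaar (frontier W) = 0

section

variable {G : Type u} [AddCommGroup G] [TopologicalSpace G]

/-- `Γ` is a regular model set: `Γ = Λ_W` for a regular window `W` in some
cut-and-project scheme with direct space `G`. -/
def IsRegularModelSet (Γ : Set G) : Prop :=
  ∃ (H : Type u) (_ : AddCommGroup H) (_ : TopologicalSpace H) (_ : IsTopologicalAddGroup H)
    (_ : LocallyCompactSpace H) (_ : T2Space H) (_ : MeasurableSpace H) (_ : BorelSpace H)
    (S : CutAndProjectScheme G H) (W : Set H),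
    IsRegularWindow W ∧ Γ = S.projectionSet W

/-- `Γ` is an inter regular model set: `Λ_{int W} ⊆ Γ ⊆ Λ_{cl W}` for a regular window `W` in some
cut-and-project scheme with direct space `G`. -/
def IsInterRegularModelSet (Γ : Set G) : Prop :=
  ∃ (H : Type u) (_ : AddCommGroup H) (_ : TopologicalSpace H) (_ : IsTopologicalAddGroup H)
    (_ : LocallyCompactSpace H) (_ : T2Space H) (_ : MeasurableSpace H) (_ : BorelSpace H)
    (S : CutAndProjectScheme G H) (W : Set H),
    IsRegularWindow W ∧ S.projectionSet (interior W) ⊆ Γ ∧ Γ ⊆ S.projectionSet (closure W)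

/-- `Γ` is an almost regular model set: `Λ_U ⊆ Γ ⊆ Λ_W` in some cut-and-project scheme with direct
space `G`, where `U ⊆ W`, `U` is non-empty and open, `W` is compact, and `W \ U` has vanishing
Haar measure. -/
def IsAlmostRegularModelSet (Γ : Set G) : Prop :=
  ∃ (H : Type u) (_ : AddCommGroup H) (_ : TopologicalSpace H) (_ : IsTopologicalAddGroup H)
    (_ : LocallyCompactSpace H) (_ : T2Space H) (_ : MeasurableSpace H) (_ : BorelSpace H)
    (S : CutAndProjectScheme G H) (U W : Set H),
    U ⊆ W ∧ U.Nonempty ∧ IsOpen U ∧ IsCompact W ∧ Measure.addHaar (W \ U) = 0 ∧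
      S.projectionSet U ⊆ Γ ∧ Γ ⊆ S.projectionSet W

/-- The Dirac comb `∑_{x ∈ Γ} δ_x` of a locally finite set `Γ`, as a functional on the compactly
supported continuous functions; all the sums are finite for such `Γ`. -/
noncomputable def diracComb (Γ : Set G) : C_c(G, ℝ) → ℝ :=
  fun f => ∑ᶠ x ∈ Γ, f x

/-- The hull of a locally finite set `Γ`: the locally finite sets `Γ'` whose Dirac comb lies in
the vague closure of the set of Dirac combs of the translates `s + Γ`. The vague topology is that
of pointwise convergence on test functions, which is the product topology on `C_c(G, ℝ) → ℝ`. -/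
def hull (Γ : Set G) : Set (Set G) :=
  {Γ' | (∀ K : Set G, IsCompact K → (Γ' ∩ K).Finite) ∧
    diracComb Γ' ∈ closure (range fun s : G => diracComb ((fun x => s + x) '' Γ))}

end

/-!
The set `Γ` lies in its own hull, and it is itself a regular model set, for a larger internal group.
If `Λ_U ⊆ Γ ⊆ Λ_W`, the obvious window for `Γ` is `U` together with the second coordinates of the
lattice points above `Γ`. Its boundary is contained in the null set `W \ U`, so the only obstacles
are that it need not be Borel (the lattice may be uncountable) and that distinct lattice points may
have the same second coordinate. Both disappear once the second coordinates of the lattice form a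
`σ`-discrete set and determine the lattice points, because every subset of a `σ`-discrete set is
Borel.

To reach this situation, embed the lattice as an abstract group into a direct sum of copies of a
countable divisible subgroup of the circle with elements of every order, hence into a power of the
circle: map an essential direct sum of cyclic subgroups summand by summand, and extend by
divisibility; the extension is injective since its kernel meets an essential subgroup trivially.
In the product topology the families of finite support with values in a countable set are
`σ`-discrete: on those with exactly `n` non-zero coordinates, all with values in a fixed finite set,
the coordinates in the support of a member determine it. Now replace the internal group `H` by the
closure of the graph of this embedding over the projection to `H`; it projects to `H` by a proper
surjective homomorphism, along which compact null sets pull back to compact null sets.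
-/

/-- A `σ`-discrete subset of a topological space: one that is covered by countably many discrete
sets. The covering sets may be larger, which makes the notion visibly hereditary; since subsets of
discrete sets are discrete, this amounts to being a countable union of discrete sets. -/
def IsSigmaDiscrete {X : Type*} [TopologicalSpace X] (s : Set X) : Prop :=
  ∃ D : Set (Set X), D.Countable ∧ (∀ d ∈ D, IsDiscrete d) ∧ s ⊆ ⋃₀ D

theorem isLocallyClosed_of_isDiscrete {X : Type*} [TopologicalSpace X] [T1Space X] {s : Set X}
    (hs : IsDiscrete s) : IsLocallyClosed s := by
  choose! O hO hOs using isDiscrete_iff_forall_mem_exists_isOpen.1 hs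
  refine ⟨⋃ x ∈ s, O x, closure s, isOpen_biUnion hO, isClosed_closure, subset_antisymm ?_ ?_⟩
  · intro x hx
    have hxO : x ∈ O x ∩ s := (hOs x hx).symm ▸ mem_singleton x
    exact ⟨mem_biUnion hx hxO.1, subset_closure hx⟩
  · rintro y ⟨hy, hys⟩
    obtain ⟨x, hx, hyx⟩ := mem_iUnion₂.1 hy
    have hyx' : y ∈ closure (O x ∩ s) := (hO x hx).inter_closure ⟨hyx, hys⟩
    rw [hOs x hx, closure_singleton, mem_singleton_iff] at hyx'
    exact hyx' ▸ hx

namespace IsSigmaDiscrete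

theorem mono {X : Type*} [TopologicalSpace X] {s t : Set X} (ht : IsSigmaDiscrete t)
    (hst : s ⊆ t) : IsSigmaDiscrete s :=
  let ⟨D, hDc, hD, htD⟩ := ht
  ⟨D, hDc, hD, hst.trans htD⟩

theorem measurableSet {X : Type*} [TopologicalSpace X] [T1Space X] [MeasurableSpace X]
    [BorelSpace X] {s : Set X} (hs : IsSigmaDiscrete s) : MeasurableSet s := by
  obtain ⟨D, hDc, hD, hsD⟩ := hs
  have h_eq : s = ⋃ d ∈ D, s ∩ d := by rw [← inter_iUnion₂, ← sUnion_eq_biUnion,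
    inter_eq_left.2 hsD]
  rw [h_eq]
  refine MeasurableSet.biUnion hDc fun d hd => ?_
  obtain ⟨U, Z, hU, hZ, hUZ⟩ := isLocallyClosed_of_isDiscrete ((hD d hd).mono inter_subset_right)
  exact hUZ ▸ hU.measurableSet.inter hZ.measurableSet

theorem of_continuous_injOn {X Y : Type*} [TopologicalSpace X] [TopologicalSpace Y] {f : X → Y}
    {s : Set X} {t : Set Y} (ht : IsSigmaDiscrete t) (hf : Continuous f) (hfs : InjOn f s)
    (hst : MapsTo f s t) : IsSigmaDiscrete s := by
  obtain ⟨D, hDc, hD, htD⟩ := ht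
  refine ⟨(fun d => s ∩ f ⁻¹' d) '' D, hDc.image _, ?_, fun x hx => ?_⟩
  · rintro _ ⟨d, hd, rfl⟩
    refine isDiscrete_iff_forall_mem_exists_isOpen.2 fun x hx => ?_
    obtain ⟨O, hO, hOd⟩ := isDiscrete_iff_forall_mem_exists_isOpen.1 (hD d hd) (f x) hx.2
    refine ⟨f ⁻¹' O, hO.preimage hf, subset_antisymm ?_ ?_⟩
    · rintro y ⟨hyO, hys, hyd⟩
      have hyx : f y ∈ ({f x} : Set Y) := hOd ▸ ⟨hyO, hyd⟩
      exact hfs hys hx.1 hyx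
    · have hxO : f x ∈ O ∩ d := hOd.symm ▸ mem_singleton (f x)
      exact singleton_subset_iff.2 ⟨hxO.1, hx⟩
  · obtain ⟨d, hd, hxd⟩ := htD (hst hx)
    exact ⟨_, ⟨d, hd, rfl⟩, hx, hxd⟩

end IsSigmaDiscrete

theorem isDiscrete_setOf_encard_support_eq (ι : Type*) {T : Type*} [TopologicalSpace T]
    [T1Space T] [Zero T] (n : ℕ) {F : Set T} (hF : F.Finite) :
    IsDiscrete {y : ι → T | (Function.support y).encard = n ∧ range y ⊆ F} := by
  refine isDiscrete_iff_forall_mem_exists_isOpen.2 fun x ⟨hxn, hxF⟩ => ?_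
  have hx : (Function.support x).Finite := finite_of_encard_eq_coe hxn
  refine ⟨⋂ i ∈ Function.support x, Function.eval i ⁻¹' (F \ {x i})ᶜ, ?_, subset_antisymm ?_ ?_⟩
  · exact hx.isOpen_biInter fun i _ =>
      (hF.subset sdiff_subset).isClosed.isOpen_compl.preimage (continuous_apply i)
  · rintro y ⟨hy, hyn, hyF⟩
    have h_eqOn : ∀ i ∈ Function.support x, y i = x i := fun i hi =>
      not_not.1 fun hne => mem_iInter₂.1 hy i hi ⟨hyF (mem_range_self i), hne⟩
    have h_subset : Function.support x ⊆ Function.support y := fun i hi => by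
      rwa [Function.mem_support, h_eqOn i hi]
    have h_support : Function.support x = Function.support y :=
      (finite_of_encard_eq_coe hyn).eq_of_subset_of_encard_le' h_subset (hyn.trans hxn.symm).le
    funext i
    by_cases hi : i ∈ Function.support x
    · exact h_eqOn i hi
    · have hyi : i ∉ Function.support y := h_support ▸ hi
      rw [Function.notMem_support.1 hi, Function.notMem_support.1 hyi]
  · rintro _ rfl
    exact ⟨mem_iInter₂.2 fun i _ hi => hi.2 rfl, hxn, hxF⟩

theorem isSigmaDiscrete_range_coe_finsupp (ι : Type*) {T : Type*} [TopologicalSpace T] [T1Space T]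
    [Zero T] {S : Type*} [SetLike S T] [ZeroMemClass S T] (A : S) [Countable A] :
    IsSigmaDiscrete (range fun (x : ι →₀ A) (i : ι) => (x i : T)) := by
  refine ⟨image2 (fun (n : ℕ) F => {y : ι → T | (Function.support y).encard = n ∧ range y ⊆ F})
    univ {F | F.Finite ∧ F ⊆ A}, ?_, ?_, ?_⟩
  · exact countable_univ.image2 (countable_ofPred_finite_subset (to_countable _)) _
  · rintro _ ⟨n, -, F, hF, rfl⟩
    exact isDiscrete_setOf_encard_support_eq ι n hF.1
  · rintro _ ⟨x, rfl⟩
    have h_support : Function.support (fun i => (x i : T)) = x.support := by ext; simp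
    refine ⟨_, ⟨x.support.card, mem_univ _, range fun i => (x i : T), ⟨?_, ?_⟩, rfl⟩, ?_,
      subset_rfl⟩
    · rw [range_comp' Subtype.val x]
      exact x.finite_range.image _
    · rintro _ ⟨i, rfl⟩
      exact (x i).2
    · rw [h_support, encard_coe_eq_coe_finsetCard]

theorem sSupIndep_insert_of_disjoint {α : Type*} [CompleteLattice α] [IsModularLattice α]
    {s : Set α} (hs : sSupIndep s) {a : α} (ha : Disjoint a (sSup s)) :
    sSupIndep (insert a s) := by
  rintro b (rfl | hb)
  · exact ha.mono_right (sSup_le_sSup (by simp))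
  · have h_disj : Disjoint b (sSup (s \ {b}) ⊔ a) :=
      (hs hb).disjoint_sup_right_of_disjoint_sup_left <| ha.symm.mono_left <|
        sup_le (le_sSup hb) (sSup_le_sSup sdiff_subset)
    refine h_disj.mono_right (sSup_le ?_)
    rintro c ⟨rfl | hc, hcb⟩
    · exact le_sup_right
    · exact le_sup_of_le_left (le_sSup ⟨hc, hcb⟩)

theorem exists_sSupIndep_span_singleton_essential (R M : Type*) [Ring R] [AddCommGroup M]
    [Module R M] :
    ∃ s : Set (Submodule R M), sSupIndep s ∧ (∀ N ∈ s, ∃ x, N = Submodule.span R {x}) ∧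
      ∀ N : Submodule R M, Disjoint N (sSup s) → N = ⊥ := by
  obtain ⟨s, hs⟩ := zorn_subset
    {s : Set (Submodule R M) | sSupIndep s ∧ ∀ N ∈ s, ∃ x, N = Submodule.span R {x}}
    fun c hc hchain => ⟨⋃₀ c,
      ⟨iSupIndep_sUnion_of_directed hchain.directedOn fun t ht => (hc ht).1,
        fun N ⟨t, ht, hN⟩ => (hc ht).2 N hN⟩,
      fun t ht => subset_sUnion_of_mem ht⟩
  refine ⟨s, hs.prop.1, hs.prop.2, fun N hN => (Submodule.eq_bot_iff N).2 fun y hy => ?_⟩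
  have h_disj : Disjoint (Submodule.span R {y}) (sSup s) :=
    hN.mono_left ((Submodule.span_singleton_le_iff_mem y N).2 hy)
  have h_mem : Submodule.span R {y} ∈ s := by
    refine hs.mem_of_prop_insert ⟨sSupIndep_insert_of_disjoint hs.prop.1 h_disj, ?_⟩
    rintro _ (rfl | hN')
    exacts [⟨y, rfl⟩, hs.prop.2 _ hN']
  exact Submodule.span_singleton_eq_bot.1 (h_disj.eq_bot_of_le (le_sSup h_mem))

theorem exists_injective_span_singleton_of_torsionOf_eq {R M Q : Type*} [Ring R] [AddCommGroup M]
    [Module R M] [AddCommGroup Q] [Module R Q] {x : M} {a : Q}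
    (h : Ideal.torsionOf R M x = Ideal.torsionOf R Q a) :
    ∃ e : Submodule.span R {x} →ₗ[R] Q, Function.Injective e :=
  let φ := (Ideal.quotTorsionOfEquivSpanSingleton R M x).symm ≪≫ₗ
    Submodule.quotEquivOfEq _ _ h ≪≫ₗ Ideal.quotTorsionOfEquivSpanSingleton R Q a
  ⟨(Submodule.span R {a}).subtype ∘ₗ φ.toLinearMap, Subtype.val_injective.comp φ.injective⟩

theorem exists_injective_linearMap_finsupp {R : Type*} {M : Type u} {Q : Type*} [Ring R]
    [AddCommGroup M] [Module R M] [AddCommGroup Q] [Module R Q]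
    (hQ : ∀ ι : Type u, Module.Baer R (ι →₀ Q))
    (htor : ∀ x : M, ∃ a : Q, Ideal.torsionOf R M x = Ideal.torsionOf R Q a) :
    ∃ (ι : Type u) (f : M →ₗ[R] ι →₀ Q), Function.Injective f := by
  classical
  obtain ⟨s, h_indep, h_cyclic, h_ess⟩ := exists_sSupIndep_span_singleton_essential R M
  have h_embed : ∀ N : s, ∃ e : (N : Submodule R M) →ₗ[R] Q, Function.Injective e := by
    rintro ⟨N, hN⟩
    obtain ⟨x, rfl⟩ := h_cyclic N hN
    obtain ⟨a, ha⟩ := htor x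
    exact exists_injective_span_singleton_of_torsionOf_eq ha
  choose e he using h_embed
  let j : (Π₀ N : s, (N : Submodule R M)) →ₗ[R] M :=
    DFinsupp.lsum ℕ fun N : s => (N : Submodule R M).subtype
  have hj : Function.Injective j := ((sSupIndep_iff s).1 h_indep).dfinsupp_lsum_injective
  let g : (Π₀ N : s, (N : Submodule R M)) →ₗ[R] s →₀ Q :=
    (finsuppLequivDFinsupp R).symm.toLinearMap ∘ₗ DFinsupp.mapRange.linearMap e
  have hg : Function.Injective g := (finsuppLequivDFinsupp R).symm.injective.comp
    ((DFinsupp.mapRange_injective _ fun N => map_zero (e N)).2 he)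
  obtain ⟨f, hf⟩ := (hQ s).extension_property j hj g
  refine ⟨s, f, LinearMap.ker_eq_bot.1 <| h_ess _ <| Submodule.disjoint_def.2 fun z hz hzs => ?_⟩
  rw [sSup_eq_iSup', Submodule.mem_iSup_iff_exists_dfinsupp] at hzs
  obtain ⟨w, rfl⟩ := hzs
  have hgw : g w = 0 := (LinearMap.congr_fun hf w).symm.trans hz
  rw [(map_eq_zero_iff g hg).1 hgw, map_zero]

theorem baer_int_finsupp (ι A : Type*) [AddCommGroup A] [DivisibleBy A ℤ] :
    Module.Baer ℤ (ι →₀ A) := by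
  let : DivisibleBy (ι →₀ A) ℤ := divisibleByOfSMulRightSurj _ _ fun {n} hn =>
    Finsupp.mapRange_surjective (n • ·) (smul_zero n) (DivisibleBy.surjective_smul A ℤ hn)
  exact Module.Baer.of_divisible _

theorem torsionOf_int_eq_of_addOrderOf_eq {A B : Type*} [AddCommGroup A] [AddCommGroup B] {a : A}
    {b : B} (h : addOrderOf a = addOrderOf b) :
    Ideal.torsionOf ℤ A a = Ideal.torsionOf ℤ B b := by
  ext n
  rw [Ideal.mem_torsionOf_iff, Ideal.mem_torsionOf_iff, ← addOrderOf_dvd_iff_zsmul_eq_zero,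
    ← addOrderOf_dvd_iff_zsmul_eq_zero, h]

/-- The points of the circle `ℝ / ℤ` represented by real algebraic numbers. This serves as a
countable divisible subgroup that contains elements of every order, including infinite order. -/
noncomputable def algebraicCircle : AddSubgroup UnitAddCircle :=
  (algebraicClosure ℚ ℝ).toSubfield.toAddSubgroup.map
    (QuotientAddGroup.mk' (AddSubgroup.zmultiples (1 : ℝ)))

instance : Countable algebraicCircle :=
  have h_alg : (algebraicClosure ℚ ℝ : Set ℝ).Countable :=
    (Algebraic.countable ℚ ℝ).mono fun _ => mem_algebraicClosure_iff.1
  (h_alg.image _).to_subtype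

noncomputable instance : DivisibleBy algebraicCircle ℤ :=
  have : DivisibleBy (algebraicClosure ℚ ℝ).toSubfield.toAddSubgroup ℤ :=
    inferInstanceAs (DivisibleBy (algebraicClosure ℚ ℝ) ℤ)
  (AddMonoidHom.addSubgroupMap_surjective
    (QuotientAddGroup.mk' (AddSubgroup.zmultiples (1 : ℝ)))
    (algebraicClosure ℚ ℝ).toSubfield.toAddSubgroup).divisibleBy _ fun a n => map_zsmul _ n a

theorem exists_addOrderOf_algebraicCircle_eq (n : ℕ) : ∃ a : algebraicCircle, addOrderOf a = n := by
  suffices ∃ x : ℝ, IsAlgebraic ℚ x ∧ addOrderOf (x : UnitAddCircle) = n by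
    obtain ⟨x, hx, hxn⟩ := this
    exact ⟨⟨x, x, mem_algebraicClosure_iff.2 hx, rfl⟩, (AddSubgroup.addOrderOf_mk _ _).trans hxn⟩
  obtain rfl | hn := n.eq_zero_or_pos
  · refine ⟨√2, ?_, addOrderOf_eq_zero_iff.2 ?_⟩
    · exact .of_pow two_pos (by simpa using isAlgebraic_natCast 2)
    · rw [AddCircle.isOfFinAddOrder_iff_exists_rat_eq_div]
      rintro ⟨q, hq⟩
      exact irrational_sqrt_two ⟨q, by simpa using hq⟩
  · exact ⟨1 / n, one_div (n : ℝ) ▸ (isAlgebraic_natCast n).inv,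
      AddCircle.addOrderOf_period_div hn⟩

theorem exists_injective_isSigmaDiscrete_range (L : Type u) [AddCommGroup L] :
    ∃ (ι : Type u) (ψ : L →+ ι → UnitAddCircle),
      Function.Injective ψ ∧ IsSigmaDiscrete (range ψ) := by
  obtain ⟨ι, f, hf⟩ := exists_injective_linearMap_finsupp (R := ℤ) (M := L)
    (baer_int_finsupp · algebraicCircle) fun x =>
      let ⟨a, ha⟩ := exists_addOrderOf_algebraicCircle_eq (addOrderOf x)
      ⟨a, torsionOf_int_eq_of_addOrderOf_eq ha.symm⟩
  refine ⟨ι, (algebraicCircle.subtype.compLeft ι).comp (Finsupp.coeFnAddHom.comp f.toAddMonoidHom),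
    (Subtype.val_injective.comp_left.comp DFunLike.coe_injective).comp hf,
    (isSigmaDiscrete_range_coe_finsupp ι algebraicCircle).mono ?_⟩
  rintro _ ⟨l, rfl⟩
  exact ⟨f l, rfl⟩

theorem exists_isProperMap_isSigmaDiscrete_range {L H : Type u} [AddCommGroup L] [AddCommGroup H]
    [TopologicalSpace H] [IsTopologicalAddGroup H] [LocallyCompactSpace H] [T2Space H]
    (f : L →+ H) :
    ∃ (X : Type u) (_ : AddCommGroup X) (_ : TopologicalSpace X) (_ : IsTopologicalAddGroup X)
      (_ : LocallyCompactSpace X) (_ : T2Space X) (p : X →+ H) (σ : L →+ X),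
      IsProperMap p ∧ (∀ l, p (σ l) = f l) ∧ DenseRange σ ∧ Function.Injective σ ∧
        IsSigmaDiscrete (range σ) := by
  obtain ⟨ι, ψ, hψ, hψD⟩ := exists_injective_isSigmaDiscrete_range L
  let graph : AddSubgroup (H × (ι → UnitAddCircle)) := (f.prod ψ).range
  have h_emb : Topology.IsClosedEmbedding graph.topologicalClosure.subtype :=
    graph.isClosed_topologicalClosure.isClosedEmbedding_subtypeVal
  let coord : graph.topologicalClosure → ι → UnitAddCircle := fun x => x.1.2
  let σ : L →+ graph.topologicalClosure :=
    (AddSubgroup.inclusion graph.le_topologicalClosure).comp (f.prod ψ).rangeRestrict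
  have h_dense : DenseRange σ := by
    rw [DenseRange, Subtype.dense_iff, ← range_comp]
    exact graph.topologicalClosure_coe.le
  refine ⟨graph.topologicalClosure, _, _, inferInstance, h_emb.locallyCompactSpace, inferInstance,
    (AddMonoidHom.fst H _).comp graph.topologicalClosure.subtype, σ,
    isProperMap_fst_of_compactSpace.comp h_emb.isProperMap, fun _ => rfl, h_dense,
    fun l l' h => hψ (congrArg coord h),
    hψD.of_continuous_injOn (continuous_snd.comp continuous_subtype_val : Continuous coord) ?_ ?_⟩
  · rintro _ ⟨l, rfl⟩ _ ⟨l', rfl⟩ h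
    rw [hψ h]
  · rintro _ ⟨l, rfl⟩
    exact mem_range_self l

theorem exists_isCompact_image_eq_univ {X Y : Type*} [TopologicalSpace X]
    [WeaklyLocallyCompactSpace X] [TopologicalSpace Y] [CompactSpace Y] {f : X → Y}
    (hf : IsOpenQuotientMap f) : ∃ C : Set X, IsCompact C ∧ f '' C = univ := by
  choose K hK hKx using fun x : X => exists_compact_mem_nhds x
  obtain ⟨t, ht⟩ := (isCompact_univ (X := Y)).elim_finite_subcover
    (fun x : X => f '' interior (K x)) (fun x => hf.isOpenMap _ isOpen_interior)
    (fun y _ => by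
      obtain ⟨x, rfl⟩ := hf.surjective y
      exact mem_iUnion.2 ⟨x, x, mem_interior_iff_mem_nhds.2 (hKx x), rfl⟩)
  refine ⟨⋃ x ∈ t, K x, t.isCompact_biUnion fun x _ => hK x, univ_subset_iff.1 ?_⟩
  rw [image_iUnion₂]
  exact ht.trans (iUnion₂_mono fun x _ => image_mono interior_subset)

theorem addHaar_preimage_eq_zero {X Y : Type*} [AddGroup X] [TopologicalSpace X]
    [IsTopologicalAddGroup X] [MeasurableSpace X] [BorelSpace X] [AddGroup Y]
    [TopologicalSpace Y] [IsTopologicalAddGroup Y] [LocallyCompactSpace Y] [T2Space Y]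
    [MeasurableSpace Y] [BorelSpace Y] (μ : Measure X) [μ.IsAddHaarMeasure] (ν : Measure Y)
    [ν.IsAddHaarMeasure] {p : X →+ Y} (hp : IsProperMap p) (hps : Function.Surjective p)
    {N : Set Y} (hN : IsCompact (closure N)) (hNν : ν N = 0) : μ (p ⁻¹' N) = 0 := by
  have : (μ.map p).IsAddHaarMeasure :=
    Measure.isAddHaarMeasure_map μ p hp.continuous hps (isProperMap_iff_tendsto_cocompact.1 hp).2
  refine le_antisymm ?_ bot_le
  calc μ (p ⁻¹' N) ≤ μ.map p N := Measure.le_map_apply hp.continuous.measurable.aemeasurable N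
    _ = 0 := by
      rw [Measure.measure_isAddInvariant_eq_smul_of_isCompact_closure (μ.map p) ν hN, hNν,
        smul_zero]

/-- The pairs `U ⊆ W` of windows that enter the definition of an almost regular model set: `U` is
non-empty and open, `W` is compact, and `W \ U` is a null set. -/
structure IsWindowPair {H : Type*} [AddCommGroup H] [TopologicalSpace H]
    [IsTopologicalAddGroup H] [LocallyCompactSpace H] [MeasurableSpace H] [BorelSpace H]
    (U W : Set H) : Prop where
  subset : U ⊆ W
  nonempty : U.Nonempty
  isOpen : IsOpen U
  isCompact : IsCompact W
  addHaar_sdiff : Measure.addHaar (W \ U) = 0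

namespace IsWindowPair

theorem isRegularWindow {H : Type u} [AddCommGroup H] [TopologicalSpace H]
    [IsTopologicalAddGroup H] [LocallyCompactSpace H] [T2Space H] [MeasurableSpace H]
    [BorelSpace H] {U V W : Set H} (h : IsWindowPair U W) (hV : MeasurableSet V) (hUV : U ⊆ V)
    (hVW : V ⊆ W) : IsRegularWindow V := by
  have h_interior : U ⊆ interior V := interior_maximal hUV h.isOpen
  have h_closure : closure V ⊆ W := closure_minimal hVW h.isCompact.isClosed
  exact ⟨h.isCompact.of_isClosed_subset isClosed_closure h_closure, hV, h.nonempty.mono h_interior,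
    measure_mono_null (sdiff_subset_sdiff h_closure h_interior) h.addHaar_sdiff⟩

theorem preimage {X H : Type*} [AddCommGroup X] [TopologicalSpace X] [IsTopologicalAddGroup X]
    [LocallyCompactSpace X] [MeasurableSpace X] [BorelSpace X] [AddCommGroup H]
    [TopologicalSpace H] [IsTopologicalAddGroup H] [LocallyCompactSpace H] [T2Space H]
    [MeasurableSpace H] [BorelSpace H] {U W : Set H} (h : IsWindowPair U W) {p : X →+ H}
    (hp : IsProperMap p) (hps : Function.Surjective p) : IsWindowPair (p ⁻¹' U) (p ⁻¹' W) where
  subset := preimage_mono h.subset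
  nonempty := h.nonempty.preimage hps
  isOpen := h.isOpen.preimage hp.continuous
  isCompact := hp.isCompact_preimage h.isCompact
  addHaar_sdiff := addHaar_preimage_eq_zero _ _ hp hps (h.isCompact.diff h.isOpen).closure
    h.addHaar_sdiff

end IsWindowPair

namespace CutAndProjectScheme

variable {G H : Type u} [AddCommGroup G] [TopologicalSpace G] [AddCommGroup H]
  [TopologicalSpace H]

section Lift

variable {X : Type u} [AddCommGroup X] [TopologicalSpace X] (S : CutAndProjectScheme G H)
  {p : X →+ H} (hp : IsProperMap p) (σ : S.lattice →+ X) (hσ : ∀ l, p (σ l) = (l : G × H).2)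
  (hσd : DenseRange σ)

include hp hσ in
theorem surjective_of_lift : Function.Surjective p := by
  have h_dense : DenseRange p := S.dense_snd.mono <| by
    rintro _ ⟨l, hl, rfl⟩
    exact ⟨σ ⟨l, hl⟩, hσ ⟨l, hl⟩⟩
  rw [← range_eq_univ, ← hp.isClosedMap.isClosed_range.closure_eq, h_dense.closure_range]

/-- The cut-and-project scheme obtained from `S` by replacing the internal space `H` with `X` and
the second coordinate of the lattice point `l` with `σ l`. -/
def lift [IsTopologicalAddGroup G] [LocallyCompactSpace G] [IsTopologicalAddGroup H]
    [LocallyCompactSpace H] : CutAndProjectScheme G X where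
  lattice := (((AddMonoidHom.fst G H).comp S.lattice.subtype).prod σ).range
  discrete := by
    have := S.discrete
    let proj : (((AddMonoidHom.fst G H).comp S.lattice.subtype).prod σ).range → S.lattice :=
      fun x => ⟨(x.1.1, p x.1.2), by
        obtain ⟨_, l, rfl⟩ := x
        exact (Prod.ext rfl (hσ l).symm : (l : G × H) = (l.1.1, p (σ l))) ▸ l.2⟩
    have h_proj : Continuous proj := by
      have := hp.continuous
      fun_prop
    refine DiscreteTopology.of_continuous_injective h_proj ?_
    rintro ⟨_, l, rfl⟩ ⟨_, l', rfl⟩ h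
    have h_fst : (l : G × H).1 = (l' : G × H).1 := (congrArg (fun m : S.lattice => m.1.1) h :)
    rw [Subtype.ext (S.injOn_fst l.2 l'.2 h_fst)]
  cocompact := by
    have := S.cocompact
    obtain ⟨C, hC, hC_univ⟩ := exists_isCompact_image_eq_univ
      (QuotientAddGroup.isOpenQuotientMap_mk (N := S.lattice))
    have hC' : IsCompact (Prod.map id p ⁻¹' C) := (isProperMap_id.prodMap hp).isCompact_preimage hC
    refine ⟨(hC'.image continuous_quot_mk).of_isClosed_subset isClosed_univ fun q _ => ?_⟩
    obtain ⟨x, rfl⟩ := QuotientAddGroup.mk_surjective q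
    obtain ⟨c, hc, hcx⟩ := hC_univ.ge (mem_univ (QuotientAddGroup.mk (x.1, p x.2)))
    let l : S.lattice := ⟨-c + (x.1, p x.2), QuotientAddGroup.eq.1 hcx⟩
    refine ⟨x - (l.1.1, σ l), ?_, QuotientAddGroup.eq.2 ⟨l, ?_⟩⟩
    · have h_eq : Prod.map id p (x - (l.1.1, σ l)) = c := by ext <;> simp [l, hσ]
      exact mem_preimage.2 (h_eq ▸ hc)
    · simp
  injOn_fst := by
    rintro _ ⟨l, rfl⟩ _ ⟨l', rfl⟩ h
    rw [Subtype.ext (S.injOn_fst l.2 l'.2 h)]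
  dense_snd := hσd.mono <| by
    rintro _ ⟨l, rfl⟩
    exact ⟨_, ⟨l, rfl⟩, rfl⟩

variable [IsTopologicalAddGroup G] [LocallyCompactSpace G] [IsTopologicalAddGroup H]
  [LocallyCompactSpace H]

theorem snd_image_lattice_lift :
    Prod.snd '' ((S.lift hp σ hσ hσd).lattice : Set (G × X)) = range σ :=
  (range_comp _ _).symm

theorem injOn_snd_lattice_lift (hσi : Function.Injective σ) :
    InjOn Prod.snd ((S.lift hp σ hσ hσd).lattice : Set (G × X)) := by
  rintro _ ⟨l, rfl⟩ _ ⟨l', rfl⟩ h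
  rw [hσi h]

theorem projectionSet_lift_preimage (W : Set H) :
    (S.lift hp σ hσ hσd).projectionSet (p ⁻¹' W) = S.projectionSet W := by
  ext g
  constructor
  · rintro ⟨_, ⟨⟨l, rfl⟩, -, hl⟩, rfl⟩
    exact ⟨l, ⟨l.2, trivial, hσ l ▸ hl⟩, rfl⟩
  · rintro ⟨l, ⟨hl, -, hlW⟩, rfl⟩
    exact ⟨_, ⟨⟨⟨l, hl⟩, rfl⟩, trivial, mem_preimage.2 ((hσ ⟨l, hl⟩).symm ▸ hlW)⟩, rfl⟩

end Lift

theorem exists_isRegularWindow_eq_projectionSet [IsTopologicalAddGroup H] [LocallyCompactSpace H]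
    [T2Space H] [MeasurableSpace H] [BorelSpace H] (S : CutAndProjectScheme G H)
    (h_inj : InjOn Prod.snd (S.lattice : Set (G × H)))
    (hD : IsSigmaDiscrete (Prod.snd '' (S.lattice : Set (G × H)))) {U W : Set H}
    (hUW : IsWindowPair U W) {Γ : Set G} (hUΓ : S.projectionSet U ⊆ Γ)
    (hΓW : Γ ⊆ S.projectionSet W) : ∃ V, IsRegularWindow V ∧ Γ = S.projectionSet V := by
  let E : Set H := Prod.snd '' {l ∈ (S.lattice : Set (G × H)) | l.1 ∈ Γ}
  have hE : MeasurableSet E := (hD.mono (image_mono (sep_subset _ _))).measurableSet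
  have hEW : E ⊆ W := by
    rintro _ ⟨l, ⟨hl, hlΓ⟩, rfl⟩
    obtain ⟨l', ⟨hl', -, hlW⟩, h_eq⟩ := hΓW hlΓ
    exact S.injOn_fst hl' hl h_eq ▸ hlW
  refine ⟨U ∪ E, hUW.isRegularWindow (hUW.isOpen.measurableSet.union hE) subset_union_left
    (union_subset hUW.subset hEW), subset_antisymm (fun g hg => ?_) ?_⟩
  · obtain ⟨l, ⟨hl, -, -⟩, rfl⟩ := hΓW hg
    exact ⟨l, ⟨hl, trivial, .inr ⟨l, ⟨hl, hg⟩, rfl⟩⟩, rfl⟩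
  · rintro _ ⟨l, ⟨hl, -, hlU | ⟨l', ⟨hl', hlΓ⟩, h_eq⟩⟩, rfl⟩
    · exact hUΓ ⟨l, ⟨hl, trivial, hlU⟩, rfl⟩
    · exact h_inj hl' hl h_eq ▸ hlΓ

theorem finite_projectionSet_inter [IsTopologicalAddGroup G] [T2Space G] [IsTopologicalAddGroup H]
    [T2Space H] (S : CutAndProjectScheme G H) {W : Set H} (hW : IsCompact W) {C : Set G}
    (hC : IsCompact C) : (S.projectionSet W ∩ C).Finite := by
  have := S.discrete
  have h_closed : IsClosed (S.lattice : Set (G × H)) := AddSubgroup.isClosed_of_discrete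
  have h_discrete : IsDiscrete (S.lattice : Set (G × H)) := isDiscrete_iff_discreteTopology.2 this
  have h_finite : (C ×ˢ W ∩ (S.lattice : Set (G × H))).Finite :=
    ((hC.prod hW).inter_right h_closed).finite (h_discrete.mono inter_subset_right)
  refine (h_finite.image Prod.fst).subset ?_
  rintro _ ⟨⟨l, ⟨hl, -, hlW⟩, rfl⟩, hlC⟩
  exact ⟨l, ⟨⟨hlC, hlW⟩, hl⟩, rfl⟩

end CutAndProjectScheme

section

variable {G : Type u} [AddCommGroup G] [TopologicalSpace G] {Γ : Set G}

theorem mem_hull_self (h : ∀ C : Set G, IsCompact C → (Γ ∩ C).Finite) : Γ ∈ hull Γ :=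
  ⟨h, subset_closure ⟨0, by simp⟩⟩

theorem IsInterRegularModelSet.isAlmostRegularModelSet (h : IsInterRegularModelSet Γ) :
    IsAlmostRegularModelSet Γ :=
  let ⟨H, _, _, _, _, _, _, _, S, W, hW, hWΓ, hΓW⟩ := h
  ⟨H, _, _, _, _, ‹_›, _, ‹_›, S, interior W, closure W, interior_subset_closure,
    hW.interior_nonempty, isOpen_interior, hW.isCompact_closure, hW.haar_frontier, hWΓ, hΓW⟩

theorem IsAlmostRegularModelSet.mem_hull [IsTopologicalAddGroup G] [T2Space G]
    (h : IsAlmostRegularModelSet Γ) : Γ ∈ hull Γ := by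
  obtain ⟨H, _, _, _, _, _, _, _, S, U, W, -, -, -, hW, -, -, hΓW⟩ := h
  exact mem_hull_self fun C hC =>
    (S.finite_projectionSet_inter hW hC).subset (inter_subset_inter_left C hΓW)

theorem IsAlmostRegularModelSet.isRegularModelSet [IsTopologicalAddGroup G]
    [LocallyCompactSpace G] (h : IsAlmostRegularModelSet Γ) : IsRegularModelSet Γ := by
  obtain ⟨H, _, _, _, _, _, _, _, S, U, W, h_sub, hU_ne, hU, hW, h_null, hUΓ, hΓW⟩ := h
  obtain ⟨X, _, _, _, _, _, p, σ, hp, hσ, hσd, hσi, hσD⟩ :=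
    exists_isProperMap_isSigmaDiscrete_range ((AddMonoidHom.snd G H).comp S.lattice.subtype)
  let _ : MeasurableSpace X := borel X
  have : BorelSpace X := ⟨rfl⟩
  let S' : CutAndProjectScheme G X := S.lift hp σ hσ hσd
  have h_windows : IsWindowPair (p ⁻¹' U) (p ⁻¹' W) :=
    IsWindowPair.preimage ⟨h_sub, hU_ne, hU, hW, h_null⟩ hp (S.surjective_of_lift hp σ hσ)
  obtain ⟨V, hV, hΓ⟩ := S'.exists_isRegularWindow_eq_projectionSet
    (S.injOn_snd_lattice_lift hp σ hσ hσd hσi)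
    ((S.snd_image_lattice_lift hp σ hσ hσd).symm ▸ hσD) h_windows
    ((S.projectionSet_lift_preimage hp σ hσ hσd U).trans_subset hUΓ)
    (hΓW.trans_eq (S.projectionSet_lift_preimage hp σ hσ hσd W).symm)
  exact ⟨X, _, _, ‹_›, ‹_›, ‹_›, _, ‹_›, S', V, hV, hΓ⟩

theorem mainTheorem7_general [IsTopologicalAddGroup G] [LocallyCompactSpace G] [T2Space G]
    (h : IsAlmostRegularModelSet Γ) : Γ ∈ hull Γ ∧ IsRegularModelSet Γ :=
  ⟨h.mem_hull, h.isRegularModelSet⟩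

end

theorem mainTheorem7 {G : Type u} [AddCommGroup G] [TopologicalSpace G] [IsTopologicalAddGroup G]
    [LocallyCompactSpace G] [T2Space G] (Γ : Set G) :
    (IsAlmostRegularModelSet Γ → ∃ Γ' ∈ hull Γ, IsRegularModelSet Γ') ∧
      (IsInterRegularModelSet Γ → ∃ Γ' ∈ hull Γ, IsRegularModelSet Γ') :=
  ⟨fun h => ⟨Γ, mainTheorem7_general h⟩,
    fun h => ⟨Γ, mainTheorem7_general h.isAlmostRegularModelSet⟩⟩
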